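/- Let $n\ge 1$, $s\in(0,1)$, and let $K\subset\mathbb R^n$ be an origin-symmetric convex body (compact, convex, with non-empty interior) which is symmetric with respect to the hyperplane $\{x_n=0\}$. Let $\|\cdot\|_K$ be the norm on $\mathbb R^n$ with closed unit ball $K$, and for a Borel set $E\subseteq\mathbb R^n$ with complement $E^c$ let $$P_s(E,K)=\int_E\int_{E^c}\frac{1}{\|x-y\|_K^{\,n+s}}\,dy\,dx\in[0,\infty].$$ Write $x=(x',x_n)\in\mathbb R^{n-1}\times\mathbb R$ and $E_{x'}=\{t\in\mathbb R:(x',t)\in E\}$. The Steiner symmetrization $E^{\#}$ of $E$ with respect to $x_n$ is the set whose section over each $x'\in\mathbb R^{n-1}$ is $(E^{\#})_{x'}=[-r,r]$ with $2r=|E_{x'}|$ if $|E_{x'}|<\infty$, and $(E^{\#})_{x'}=\mathbb R$ if $|E_{x'}|=\infty$. Two sets are called equivalent if they differ by a set of Lebesgue measure $0$. Let $E\subset\mathbb R^n$ be a Borel set of finite Lebesgue measure. Then $$P_s(E,K)\ \ge\ P_s(E^{\#},K).$$ Furthermore, assume that $K$ is strictly convex. If $E$ is equivalent to a translate of $E^{\#}$,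 then $P_s(E,K)=P_s(E^{\#},K)$. Conversely, if $P_s(E,K)<\infty$ and $P_s(E,K)=P_s(E^{\#},K)$, then $E$ is equivalent to a translate of $E^{\#}$. -/

import Mathlib

open MeasureTheory
open scoped ENNReal

/-- A convex body in `ℝⁿ`: a compact convex set with non-empty interior. -/
def IsConvexBody {n : ℕ} (K : Set (EuclideanSpace ℝ (Fin n))) : Prop :=
  IsCompact K ∧ Convex ℝ K ∧ (interior K).Nonempty

/-- The set `K` is symmetric with respect to the origin. -/
def IsOriginSymmetric {n : ℕ} (K : Set (EuclideanSpace ℝ (Fin n))) : Prop :=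
  ∀ x ∈ K, -x ∈ K

/-- The anisotropic fractional perimeter
`P_s(E, K) = ∫_E ∫_{Eᶜ} 1 / ‖x - y‖_K ^ (n + s) dy dx ∈ [0, ∞]` of `E ⊆ ℝⁿ`.
For an origin-symmetric convex body `K`, the Minkowski functional `gauge K` is the norm
`‖·‖_K` with closed unit ball `K`. -/
noncomputable def fracPerimeter {n : ℕ} (s : ℝ) (E K : Set (EuclideanSpace ℝ (Fin n))) : ℝ≥0∞ :=
  ∫⁻ x in E, ∫⁻ y in Eᶜ, ENNReal.ofReal (1 / gauge K (x - y) ^ ((n : ℝ) + s))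

/-- The point `(x', t) ∈ ℝ^(d+1)` with first coordinates `x' ∈ ℝ^d` and last coordinate `t`. -/
def joinLast {d : ℕ} (x' : EuclideanSpace ℝ (Fin d)) (t : ℝ) : EuclideanSpace ℝ (Fin (d + 1)) :=
  WithLp.toLp 2 (Fin.snoc (α := fun _ => ℝ) (fun i => x' i) t)

/-- The projection `x = (x', t) ↦ x'` forgetting the last coordinate. -/
def dropLast {d : ℕ} (x : EuclideanSpace ℝ (Fin (d + 1))) : EuclideanSpace ℝ (Fin d) :=
  WithLp.toLp 2 (fun i => x i.castSucc)

/-- The set `K` is symmetric with respect to the hyperplane on which the last coordinate is `0`. -/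
def IsSymmetricLast {d : ℕ} (K : Set (EuclideanSpace ℝ (Fin (d + 1)))) : Prop :=
  ∀ (x' : EuclideanSpace ℝ (Fin d)) (t : ℝ), joinLast x' t ∈ K → joinLast x' (-t) ∈ K

/-- The section `A_{x'} = {t ∈ ℝ | (x', t) ∈ A}`. -/
def lastSection {d : ℕ} (A : Set (EuclideanSpace ℝ (Fin (d + 1))))
    (x' : EuclideanSpace ℝ (Fin d)) : Set ℝ :=
  {t | joinLast x' t ∈ A}

open Classical in
/-- The Schwarz symmetrization of `A ⊆ ℝ`: the whole line if `A` has infinite measure, and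
otherwise the closed interval centred at `0` with the same measure as `A`. -/
noncomputable def schwarzSymm (A : Set ℝ) : Set ℝ :=
  if volume A = ∞ then Set.univ else Metric.closedBall 0 ((volume A).toReal / 2)

theorem volume_schwarzSymm (A : Set ℝ) : volume (schwarzSymm A) = volume A := by
  unfold schwarzSymm
  split_ifs with h
  · rw [h, Real.volume_univ]
  · rw [Real.volume_closedBall, mul_div_cancel₀ _ (two_ne_zero), ENNReal.ofReal_toReal h]

/-- The Steiner symmetrization `A^#` with respect to the last coordinate: its section over `x'`
is the Schwarz symmetrization of the section `A_{x'}`. -/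
noncomputable def steinerSymm {d : ℕ} (A : Set (EuclideanSpace ℝ (Fin (d + 1)))) :
    Set (EuclideanSpace ℝ (Fin (d + 1))) :=
  {x | x (Fin.last d) ∈ schwarzSymm (lastSection A (dropLast x))}

theorem lastSection_steinerSymm {d : ℕ} (A : Set (EuclideanSpace ℝ (Fin (d + 1))))
    (x' : EuclideanSpace ℝ (Fin d)) :
    lastSection (steinerSymm A) x' = schwarzSymm (lastSection A x') := by
  ext t
  simp [lastSection, steinerSymm, dropLast, joinLast]

/-! By the layer-cake formula `fracPerimeter` is the integral over levels `ρ > 0` of the measure of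
pairs in `E × Eᶜ` whose difference lies in an open gauge ball `D`. For even `D` of finite measure,
the pairs in `E × Eᶜ` and those in `E × E` add up to `|E| |D|`, which symmetrization preserves. So
it suffices that symmetrization increases the number of pairs in `E × E`
(`pairMeasure_le_steinerSymm`).

By Fubini over `(x', y')` this is a question about two sections `A`, `B` on the line. The reflection
symmetry of `K` makes the section of `D` over `x' - y'` a centred interval `(-l, l)`, so the Riesz
inequality for an interval kernel, `overlap_le_overlap_schwarzSymm`, is enough. It follows from a
Pollard type bound with a free parameter `c`, which centred intervals attain for the right `c`.

If the perimeters agree and are finite, equality holds at almost every level and for almost every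
pair of sections. Strict convexity makes the gauge strictly increasing in the height, so levels can
be chosen with `l` decreasing to `L = (|A| + |B|) / 2`. For `l > L` the symmetrized overlap is all
of `|A| |B|`, so `|t - u| ≤ L` almost everywhere on `A × B`. This forces `A` and `B` to be intervals
with one centre (`ae_eq_closedBall_essCenter`); the common centre of all sections gives the
translation. -/

/-! ### Riesz rearrangement on the line for interval kernels -/

/-- The measure of the set of pairs `(t, u) ∈ A × B` with `t - u ∈ S`. -/
noncomputable def overlap (A B S : Set ℝ) : ℝ≥0∞ :=
  volume ((A ×ˢ B) ∩ {p : ℝ × ℝ | p.1 - p.2 ∈ S})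

theorem measurableSet_sub_mem {S : Set ℝ} (hS : MeasurableSet S) :
    MeasurableSet {p : ℝ × ℝ | p.1 - p.2 ∈ S} :=
  (measurable_fst.sub measurable_snd) hS

theorem volume_eq_lintegral_shear {D : Set (ℝ × ℝ)} (hD : MeasurableSet D) :
    volume D = ∫⁻ w, volume {u : ℝ | (w + u, u) ∈ D} := by
  have h := measurePreserving_add_prod (volume : Measure ℝ) (volume : Measure ℝ)
  rw [Measure.volume_eq_prod, ← h.measure_preimage hD.nullMeasurableSet,
    Measure.prod_apply (h.measurable hD)]
  rfl

/-- Pairs avoiding both `P` and `Q` are bounded by the full product. The others are sliced along `t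
- u = w`: two lower sets of the line are nested, so each slice sees only one of `A ∩ P`, `B ∩ Q` and
has measure at most `c`, not `2c`. -/
theorem overlap_le_mul_add_mul {A B S P Q : Set ℝ} {c : ℝ≥0∞} (hA : MeasurableSet A)
    (hB : MeasurableSet B) (hS : MeasurableSet S) (hP : IsLowerSet P) (hQ : IsLowerSet Q)
    (hAP : volume (A ∩ P) ≤ c) (hBQ : volume (B ∩ Q) ≤ c) :
    overlap A B S ≤ volume (A \ P) * volume (B \ Q) + c * volume S := by
  have hPm : MeasurableSet P := hP.ordConnected.measurableSet
  have hQm : MeasurableSet Q := hQ.ordConnected.measurableSet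
  set G : Set (ℝ × ℝ) := (A ×ˢ B) ∩ {p | p.1 - p.2 ∈ S} ∩ {p | p.1 ∈ P ∨ p.2 ∈ Q} with hG
  have hGm : MeasurableSet G :=
    ((hA.prod hB).inter (measurableSet_sub_mem hS)).inter
      ((measurable_fst hPm).union (measurable_snd hQm))
  have hsub : (A ×ˢ B) ∩ {p : ℝ × ℝ | p.1 - p.2 ∈ S} ⊆ ((A \ P) ×ˢ (B \ Q)) ∪ G := by
    rintro ⟨t, u⟩ ⟨⟨ht, hu⟩, hs⟩
    by_cases h : t ∈ P ∨ u ∈ Q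
    · exact Or.inr ⟨⟨⟨ht, hu⟩, hs⟩, h⟩
    · push Not at h
      exact Or.inl ⟨⟨ht, h.1⟩, hu, h.2⟩
  have hfib : ∀ w, volume {u : ℝ | (w + u, u) ∈ G} ≤ S.indicator (fun _ => c) w := by
    intro w
    by_cases hw : w ∈ S
    · rw [Set.indicator_of_mem hw]
      have hP' : IsLowerSet {u : ℝ | w + u ∈ P} := fun a b hab ha =>
        hP (by linarith : w + b ≤ w + a) ha
      rcases hP'.total hQ with h | h
      · refine (measure_mono ?_).trans hBQ
        rintro u ⟨⟨⟨-, hu⟩, -⟩, h1 | h1⟩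
        · exact ⟨hu, h h1⟩
        · exact ⟨hu, h1⟩
      · have : volume ((fun u => w + u) ⁻¹' (A ∩ P)) = volume (A ∩ P) :=
          measure_preimage_add volume w _
        refine (measure_mono ?_).trans (this.le.trans hAP)
        rintro u ⟨⟨⟨hu, -⟩, -⟩, h1 | h1⟩
        · exact ⟨hu, h1⟩
        · exact ⟨hu, h h1⟩
    · rw [Set.indicator_of_notMem hw, nonpos_iff_eq_zero]
      convert measure_empty (μ := (volume : Measure ℝ))
      ext u
      simp [hG, hw]
  calc overlap A B S ≤ volume (((A \ P) ×ˢ (B \ Q)) ∪ G) := measure_mono hsub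
    _ ≤ volume ((A \ P) ×ˢ (B \ Q)) + volume G := measure_union_le _ _
    _ ≤ volume (A \ P) * volume (B \ Q) + c * volume S := by
      gcongr
      · rw [Measure.volume_eq_prod, Measure.prod_prod]
      · rw [volume_eq_lintegral_shear hGm]
        exact (lintegral_mono hfib).trans (by rw [lintegral_indicator hS, lintegral_const,
          Measure.restrict_apply_univ])

/-- Intermediate value theorem for `p ↦ |A ∩ (-∞, p]|`, which is 1-Lipschitz. The extreme values
need not be attained at a finite `p`, hence `∅` and `univ` are also allowed. -/
theorem exists_isLowerSet_volume_inter {A : Set ℝ} (hA : volume A ≠ ∞) {c : ℝ≥0∞}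
    (hc : c ≤ volume A) : ∃ P : Set ℝ, IsLowerSet P ∧ volume (A ∩ P) = c := by
  rcases hc.eq_or_lt with rfl | hc
  · exact ⟨Set.univ, isLowerSet_univ, by simp⟩
  rcases eq_or_ne c 0 with rfl | hc0
  · exact ⟨∅, isLowerSet_empty, by simp⟩
  set μ : Measure ℝ := volume.restrict A
  have : IsFiniteMeasure μ := ⟨by simpa [μ] using hA.lt_top⟩
  set f : ℝ → ℝ := fun p => μ.real (Set.Iic p) with hf
  have hlip : LipschitzWith 1 f := by
    refine LipschitzWith.of_le_add fun x y => ?_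
    have : Set.Iic x ⊆ Set.Iic y ∪ Set.Ioc y x := fun z hz => by
      by_cases h : z ≤ y
      · exact Or.inl h
      · exact Or.inr ⟨not_le.1 h, hz⟩
    have h2 : μ.real (Set.Ioc y x) ≤ dist x y := by
      refine ENNReal.toReal_le_of_le_ofReal dist_nonneg ?_
      refine (Measure.restrict_apply_le _ _).trans ?_
      rw [Real.volume_Ioc, Real.dist_eq]
      exact ENNReal.ofReal_le_ofReal (le_abs_self _)
    calc f x ≤ μ.real (Set.Iic y ∪ Set.Ioc y x) := measureReal_mono this
      _ ≤ _ := (measureReal_union_le _ _).trans (by gcongr)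
  have htop : Filter.Tendsto f Filter.atTop (nhds (μ.real Set.univ)) :=
    (ENNReal.tendsto_toReal (measure_ne_top _ _)).comp (tendsto_measure_Iic_atTop μ)
  have hbot : Filter.Tendsto f Filter.atBot (nhds 0) := by
    have h1 : Filter.Tendsto (fun p => μ (Set.Iic p)) Filter.atBot
        (nhds (μ (⋂ p, Set.Iic p))) :=
      tendsto_measure_iInter_atBot (fun _ => measurableSet_Iic.nullMeasurableSet)
        (fun _ _ h => Set.Iic_subset_Iic.2 h) ⟨0, measure_ne_top _ _⟩
    have h2 : (⋂ p : ℝ, Set.Iic p) = ∅ := by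
      ext x
      simpa using ⟨x - 1, by linarith⟩
    rw [h2, measure_empty] at h1
    exact (ENNReal.tendsto_toReal ENNReal.zero_ne_top).comp h1
  have hctop : c ≠ ∞ := hc.ne_top
  have hlt : c.toReal < μ.real Set.univ := by
    rw [measureReal_def, Measure.restrict_apply_univ]
    exact (ENNReal.toReal_lt_toReal hctop hA).2 hc
  obtain ⟨p, hp⟩ : ∃ p, f p = c.toReal :=
    mem_range_of_exists_le_of_exists_ge hlip.continuous
      ((hbot.eventually (gt_mem_nhds (ENNReal.toReal_pos hc0 hctop))).exists.imp fun _ h => h.le)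
      ((htop.eventually (lt_mem_nhds hlt)).exists.imp fun _ h => h.le)
  refine ⟨Set.Iic p, isLowerSet_Iic p, ?_⟩
  rw [Set.inter_comm, ← Measure.restrict_apply measurableSet_Iic]
  exact (ENNReal.toReal_eq_toReal_iff' (measure_ne_top _ _) hctop).1 hp

/-- A one-dimensional Pollard type inequality. -/
theorem overlap_le_sub_mul_sub_add {A B S : Set ℝ} {c : ℝ≥0∞} (hA : MeasurableSet A)
    (hB : MeasurableSet B) (hS : MeasurableSet S) (hAf : volume A ≠ ∞) (hBf : volume B ≠ ∞)
    (hcA : c ≤ volume A) (hcB : c ≤ volume B) :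
    overlap A B S ≤ (volume A - c) * (volume B - c) + c * volume S := by
  obtain ⟨P, hP, hAP⟩ := exists_isLowerSet_volume_inter hAf hcA
  obtain ⟨Q, hQ, hBQ⟩ := exists_isLowerSet_volume_inter hBf hcB
  have key : ∀ {A P : Set ℝ}, volume A ≠ ∞ → IsLowerSet P → volume (A ∩ P) = c →
      volume (A \ P) = volume A - c := by
    intro A P hAf hP h
    refine ENNReal.eq_sub_of_add_eq (h ▸ measure_ne_top_of_subset Set.inter_subset_left hAf) ?_
    rw [← h, measure_sdiff_add_inter A hP.ordConnected.measurableSet]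
  rw [← key hAf hP hAP, ← key hBf hQ hBQ]
  exact overlap_le_mul_add_mul hA hB hS hP hQ hAP.le hBQ.le

/-- Centred intervals attain the Pollard bound when `c` is `(a + b) / 2 - l` clamped to `[0, min a
b]`; `h1` and `h2` encode the clamping. `h1` puts the top box inside the strip `|t - u| < l`, and
`h2` gives every slice of the remainder its full length `c`. -/
theorem le_overlap_closedBall {a b l c : ℝ} (hl : 0 ≤ l) (hc : 0 ≤ c) (hca : c ≤ a)
    (hcb : c ≤ b) (h1 : c = a ∨ c = b ∨ (a + b) / 2 - c ≤ l)
    (h2 : c = 0 ∨ l ≤ (a + b) / 2 - c) :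
    ENNReal.ofReal ((a - c) * (b - c) + c * (2 * l)) ≤
      overlap (Metric.closedBall 0 (a / 2)) (Metric.closedBall 0 (b / 2)) (Set.Ioo (-l) l) := by
  set D : Set (ℝ × ℝ) := (Metric.closedBall 0 (a / 2) ×ˢ Metric.closedBall 0 (b / 2)) ∩
    {p : ℝ × ℝ | p.1 - p.2 ∈ Set.Ioo (-l) l} with hD
  -- `p` and `q` cut off lower pieces of length `c` from the two intervals.
  set p : ℝ := c - a / 2 with hp
  set q : ℝ := c - b / 2 with hq
  set U : Set (ℝ × ℝ) := Set.Ioi p ×ˢ Set.Ioi q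
  have hU : MeasurableSet U := measurableSet_Ioi.prod measurableSet_Ioi
  have hDm : MeasurableSet D := (measurableSet_closedBall.prod measurableSet_closedBall).inter
    (measurableSet_sub_mem measurableSet_Ioo)
  have e1 : ENNReal.ofReal ((a - c) * (b - c)) ≤ volume (D ∩ U) := by
    have : Set.Ioo p (a / 2) ×ˢ Set.Ioo q (b / 2) ⊆ D ∩ U := by
      rintro ⟨t, u⟩ ⟨⟨ht1, ht2⟩, hu1, hu2⟩
      simp only at ht1 ht2 hu1 hu2
      have hl' : (a + b) / 2 - c ≤ l := by
        rcases h1 with h | h | h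
        · linarith
        · linarith
        · exact h
      refine ⟨⟨⟨?_, ?_⟩, ?_, ?_⟩, ht1, hu1⟩
      · rw [Real.closedBall_eq_Icc]; constructor <;> simp only <;> linarith
      · rw [Real.closedBall_eq_Icc]; constructor <;> simp only <;> linarith
      · simp only; linarith
      · simp only; linarith
    refine le_trans (le_of_eq ?_) (measure_mono this)
    rw [Measure.volume_eq_prod, Measure.prod_prod, Real.volume_Ioo, Real.volume_Ioo,
      ENNReal.ofReal_mul (by linarith)]
    congr 2 <;> ring
  have e2 : ENNReal.ofReal (c * (2 * l)) ≤ volume (D \ U) := by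
    rcases h2 with h2 | h2
    · simp [h2]
    rw [volume_eq_lintegral_shear (hDm.diff hU)]
    have : ∀ w, (Set.Ioo (-l) l).indicator (fun _ => ENNReal.ofReal c) w ≤
        volume {u : ℝ | (w + u, u) ∈ D \ U} := by
      intro w
      by_cases hw : w ∉ Set.Ioo (-l) l
      · rw [Set.indicator_of_notMem hw]
        exact zero_le
      rw [not_not] at hw
      rw [Set.indicator_of_mem hw]
      -- On the slice `t = w + u`, the complement of `U` is `u ≤ max q (p - w)`; the interval of
      -- length `c` just below this point still lies in both balls.
      have hsub : Set.Ioo (max q (p - w) - c) (max q (p - w)) ⊆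
          {u : ℝ | (w + u, u) ∈ D \ U} := by
        rintro u ⟨hu1, hu2⟩
        have m1 : q ≤ max q (p - w) := le_max_left _ _
        have m2 : p - w ≤ max q (p - w) := le_max_right _ _
        have m3 : max q (p - w) ≤ b / 2 := max_le (by linarith) (by linarith [hw.1])
        have m4 : max q (p - w) ≤ a / 2 - w := max_le (by linarith [hw.2]) (by linarith)
        refine ⟨⟨⟨?_, ?_⟩, ?_⟩, ?_⟩
        · rw [Real.closedBall_eq_Icc]; constructor <;> simp only <;> linarith
        · rw [Real.closedBall_eq_Icc]; constructor <;> simp only <;> linarith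
        · simpa only [Set.mem_ofPred_eq, add_sub_cancel_right] using hw
        · rintro ⟨h3, h4⟩
          simp only [Set.mem_Ioi] at h3 h4
          rcases lt_max_iff.1 hu2 with h | h <;> linarith
      refine le_trans (le_of_eq ?_) (measure_mono hsub)
      rw [Real.volume_Ioo]
      congr 1
      ring
    refine le_trans (le_of_eq ?_) (lintegral_mono this)
    rw [lintegral_indicator measurableSet_Ioo, lintegral_const, Measure.restrict_apply_univ,
      Real.volume_Ioo, ENNReal.ofReal_mul hc]
    congr 2
    ring
  rw [overlap, ← measure_inter_add_sdiff D hU, ENNReal.ofReal_add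
    (mul_nonneg (by linarith) (by linarith)) (by positivity)]
  exact add_le_add e1 e2

/-- The Riesz rearrangement inequality on the line, for the kernel `1_{(-l, l)}`. -/
theorem overlap_le_overlap_schwarzSymm {A B : Set ℝ} (hA : MeasurableSet A)
    (hB : MeasurableSet B) (hAf : volume A ≠ ∞) (hBf : volume B ≠ ∞) {l : ℝ} (hl : 0 ≤ l) :
    overlap A B (Set.Ioo (-l) l) ≤
      overlap (schwarzSymm A) (schwarzSymm B) (Set.Ioo (-l) l) := by
  rw [schwarzSymm, schwarzSymm, if_neg hAf, if_neg hBf]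
  set a := (volume A).toReal with ha
  set b := (volume B).toReal with hb
  have ha0 : 0 ≤ a := ENNReal.toReal_nonneg
  have hb0 : 0 ≤ b := ENNReal.toReal_nonneg
  have key : ∀ c : ℝ, 0 ≤ c → c ≤ a → c ≤ b → overlap A B (Set.Ioo (-l) l) ≤
      ENNReal.ofReal ((a - c) * (b - c) + c * (2 * l)) := by
    intro c hc hca hcb
    have hA' : volume A = ENNReal.ofReal a := (ENNReal.ofReal_toReal hAf).symm
    have hB' : volume B = ENNReal.ofReal b := (ENNReal.ofReal_toReal hBf).symm
    refine (overlap_le_sub_mul_sub_add (c := ENNReal.ofReal c) hA hB measurableSet_Ioo hAf hBf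
      ?_ ?_).trans (le_of_eq ?_)
    · rw [hA']; exact ENNReal.ofReal_le_ofReal hca
    · rw [hB']; exact ENNReal.ofReal_le_ofReal hcb
    · rw [ENNReal.ofReal_add (mul_nonneg (by linarith) (by linarith)) (by positivity),
        ENNReal.ofReal_mul (by linarith), ENNReal.ofReal_mul hc, ENNReal.ofReal_sub _ hc,
        ENNReal.ofReal_sub _ hc, hA', hB', Real.volume_Ioo]
      congr 3
      ring
  -- The three cases are the clamped values of `c`: `0`, `(a + b) / 2 - l` and `min a b`.
  rcases le_total ((a + b) / 2 - l) 0 with h | h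
  · exact (key 0 le_rfl ha0 hb0).trans (le_overlap_closedBall hl le_rfl ha0 hb0
      (Or.inr (Or.inr (by linarith))) (Or.inl rfl))
  rcases le_total ((a + b) / 2 - l) (min a b) with h' | h'
  · have h3 := h'.trans (min_le_left _ _)
    have h4 := h'.trans (min_le_right _ _)
    exact (key _ h h3 h4).trans (le_overlap_closedBall hl h h3 h4
      (Or.inr (Or.inr (by linarith))) (Or.inr (by linarith)))
  · have h3 := min_le_left a b
    have h4 := min_le_right a b
    have h5 : 0 ≤ min a b := le_min ha0 hb0
    refine (key _ h5 h3 h4).trans (le_overlap_closedBall hl h5 h3 h4 ?_ (Or.inr (by linarith)))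
    rcases min_choice a b with h6 | h6
    · exact Or.inl h6
    · exact Or.inr (Or.inl h6)

/-! ### Rigidity of two sections on the line -/

/-- The centre of the smallest closed interval containing almost all of `A`. -/
noncomputable def essCenter (A : Set ℝ) : ℝ :=
  (essInf (fun t => t) (volume.restrict A) + essSup (fun t => t) (volume.restrict A)) / 2

/-- The hypothesis gives `sup A - inf B ≤ (a + b) / 2` and `sup B - inf A ≤ (a + b) / 2` for
essential bounds. Adding, the two spans total at most `a + b`, while each is at least the measure of
its set. So all these inequalities are equalities: both sets fill their spans and the midpoints
agree. -/
theorem ae_eq_closedBall_essCenter {A B : Set ℝ} (hA : MeasurableSet A) (hB : MeasurableSet B)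
    (hAf : volume A ≠ ∞) (hBf : volume B ≠ ∞) (hA0 : volume A ≠ 0) (hB0 : volume B ≠ 0)
    (h : ∀ᵐ p ∂((volume.restrict A).prod (volume.restrict B)),
      |p.1 - p.2| ≤ ((volume A).toReal + (volume B).toReal) / 2) :
    A =ᵐ[volume] Metric.closedBall (essCenter A) ((volume A).toReal / 2) ∧
      B =ᵐ[volume] Metric.closedBall (essCenter A) ((volume B).toReal / 2) := by
  set a := (volume A).toReal with ha
  set b := (volume B).toReal with hb
  have : (ae (volume.restrict A)).NeBot := by
    rw [ae_neBot]; simpa using hA0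
  have : (ae (volume.restrict B)).NeBot := by
    rw [ae_neBot]; simpa using hB0
  have h1 : ∀ᵐ t ∂volume.restrict A, ∀ᵐ u ∂volume.restrict B, |t - u| ≤ (a + b) / 2 :=
    Measure.ae_ae_of_ae_prod h
  have h2 : ∀ᵐ u ∂volume.restrict B, ∀ᵐ t ∂volume.restrict A, |t - u| ≤ (a + b) / 2 := by
    refine (Measure.ae_ae_comm (p := fun t u => |t - u| ≤ (a + b) / 2) ?_).1 h1
    exact measurableSet_le (by fun_prop) measurable_const
  have bdd : ∀ {X : Set ℝ} {x : ℝ}, (∀ᵐ t ∂volume.restrict X, |x - t| ≤ (a + b) / 2) →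
      Filter.IsBoundedUnder (· ≤ ·) (ae (volume.restrict X)) (fun t : ℝ => t) ∧
      Filter.IsBoundedUnder (· ≥ ·) (ae (volume.restrict X)) (fun t : ℝ => t) := by
    intro X x hx
    refine ⟨Filter.isBoundedUnder_of_eventually_le (a := x + (a + b) / 2) ?_,
      Filter.isBoundedUnder_of_eventually_ge (a := x - (a + b) / 2) ?_⟩
    all_goals
      filter_upwards [hx] with t ht
      linarith [(abs_le.1 ht).1, (abs_le.1 ht).2]
  obtain ⟨t0, ht0⟩ := h1.exists
  obtain ⟨u0, hu0⟩ := h2.exists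
  obtain ⟨bB1, bB2⟩ := bdd ht0
  obtain ⟨bA1, bA2⟩ := bdd (x := u0) (by simpa only [abs_sub_comm] using hu0)
  set a1 := essInf (fun t : ℝ => t) (volume.restrict A) with ha1
  set a2 := essSup (fun t : ℝ => t) (volume.restrict A) with ha2
  set b1 := essInf (fun t : ℝ => t) (volume.restrict B) with hb1
  set b2 := essSup (fun t : ℝ => t) (volume.restrict B) with hb2
  have hA1 : a2 ≤ b1 + (a + b) / 2 := by
    refine essSup_le_of_ae_le _ ?_ bA2.isCoboundedUnder_le
    filter_upwards [h1] with t ht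
    have : t - (a + b) / 2 ≤ b1 := by
      refine le_essInf_of_ae_le _ ?_ bB1.isCoboundedUnder_ge
      filter_upwards [ht] with u hu
      linarith [(abs_le.1 hu).2]
    linarith
  have hB1 : b2 ≤ a1 + (a + b) / 2 := by
    refine essSup_le_of_ae_le _ ?_ bB2.isCoboundedUnder_le
    filter_upwards [h2] with u hu
    have : u - (a + b) / 2 ≤ a1 := by
      refine le_essInf_of_ae_le _ ?_ bA1.isCoboundedUnder_ge
      filter_upwards [hu] with t ht
      linarith [(abs_le.1 ht).1]
    linarith
  have sub : ∀ {X : Set ℝ}, MeasurableSet X →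
      Filter.IsBoundedUnder (· ≤ ·) (ae (volume.restrict X)) (fun t : ℝ => t) →
      Filter.IsBoundedUnder (· ≥ ·) (ae (volume.restrict X)) (fun t : ℝ => t) →
      X ≤ᵐ[volume] Set.Icc (essInf (fun t : ℝ => t) (volume.restrict X))
        (essSup (fun t : ℝ => t) (volume.restrict X)) := by
    intro X hX k1 k2
    filter_upwards [(ae_restrict_iff' hX).1 (ae_le_essSup k1),
      (ae_restrict_iff' hX).1 (ae_essInf_le k2)] with t e1 e2 ht
    exact ⟨e2 ht, e1 ht⟩
  have len : ∀ {X : Set ℝ} {x y : ℝ}, volume X ≠ ∞ → volume X ≠ 0 →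
      X ≤ᵐ[volume] Set.Icc x y → (volume X).toReal ≤ y - x := by
    intro X x y hXf hX0 hX
    have hle := measure_mono_ae hX
    rw [Real.volume_Icc] at hle
    by_contra! hlt
    -- A non-null `X` excludes `y ≤ x`, where `ENNReal.ofReal` would truncate to `0`.
    have hpos : 0 < y - x := by
      by_contra! h0
      rw [ENNReal.ofReal_of_nonpos h0] at hle
      exact hX0 (nonpos_iff_eq_zero.1 hle)
    exact absurd (ENNReal.toReal_le_of_le_ofReal hpos.le hle) (not_le.2 hlt)
  have hAs := sub hA bA1 bA2
  have hBs := sub hB bB1 bB2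
  have lA : a ≤ a2 - a1 := len hAf hA0 hAs
  have lB : b ≤ b2 - b1 := len hBf hB0 hBs
  have fin : ∀ {X : Set ℝ} {x y : ℝ}, MeasurableSet X → volume X ≠ ∞ →
      X ≤ᵐ[volume] Set.Icc x y → y - x = (volume X).toReal → x + y = 2 * essCenter A →
      X =ᵐ[volume] Metric.closedBall (essCenter A) ((volume X).toReal / 2) := by
    intro X x y hX hXf hs hlen hc
    rw [Real.closedBall_eq_Icc, show essCenter A - (volume X).toReal / 2 = x by linarith,
      show essCenter A + (volume X).toReal / 2 = y by linarith]
    refine ae_eq_of_ae_subset_of_measure_ge hs ?_ hX.nullMeasurableSet (by simp)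
    rw [Real.volume_Icc, hlen, ENNReal.ofReal_toReal hXf]
  have hcA : essCenter A = (a1 + a2) / 2 := rfl
  exact ⟨fin hA hAf hAs (by linarith) (by linarith), fin hB hBf hBs (by linarith) (by linarith)⟩

/-! ### Splitting off the last coordinate -/

section JoinLast

variable {d : ℕ}

theorem joinLast_last (x : EuclideanSpace ℝ (Fin d)) (t : ℝ) :
    joinLast x t (Fin.last d) = t := by
  simp [joinLast]

theorem smul_joinLast (c : ℝ) (x : EuclideanSpace ℝ (Fin d)) (t : ℝ) :
    c • joinLast x t = joinLast (c • x) (c * t) := by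
  ext i
  refine Fin.lastCases ?_ (fun j => ?_) i <;> simp [joinLast]

theorem joinLast_add_joinLast (x y : EuclideanSpace ℝ (Fin d)) (t u : ℝ) :
    joinLast x t + joinLast y u = joinLast (x + y) (t + u) := by
  ext i
  refine Fin.lastCases ?_ (fun j => ?_) i <;> simp [joinLast]

theorem joinLast_sub_joinLast (x y : EuclideanSpace ℝ (Fin d)) (t u : ℝ) :
    joinLast x t - joinLast y u = joinLast (x - y) (t - u) := by
  ext i
  refine Fin.lastCases ?_ (fun j => ?_) i <;> simp [joinLast]

theorem continuous_joinLast :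
    Continuous fun p : EuclideanSpace ℝ (Fin d) × ℝ => joinLast p.1 p.2 := by
  refine (PiLp.continuous_toLp 2 _).comp (continuous_pi fun i => ?_)
  refine Fin.lastCases ?_ (fun j => ?_) i
  · simpa using continuous_snd
  · simp only [Fin.snoc_castSucc]
    fun_prop

theorem measurePreserving_joinLast :
    MeasurePreserving (fun p : EuclideanSpace ℝ (Fin d) × ℝ => joinLast p.1 p.2) := by
  have h1 := (volume_preserving_piFinSuccAbove (fun _ : Fin (d + 1) => ℝ) (Fin.last d)).symm
  have h2 : MeasurePreserving (fun p : EuclideanSpace ℝ (Fin d) × ℝ =>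
      (p.2, WithLp.ofLp p.1)) volume volume :=
    (Measure.measurePreserving_swap (μ := (volume : Measure (Fin d → ℝ)))
      (ν := (volume : Measure ℝ))).comp
      ((PiLp.volume_preserving_ofLp (Fin d)).prod (MeasurePreserving.id volume))
  have h3 := (PiLp.volume_preserving_toLp (Fin (d + 1))).comp (h1.comp h2)
  have h4 : (fun p : EuclideanSpace ℝ (Fin d) × ℝ => joinLast p.1 p.2) =
      WithLp.toLp 2 ∘ (MeasurableEquiv.piFinSuccAbove (fun _ => ℝ) (Fin.last d)).symm ∘
        fun p => (p.2, WithLp.ofLp p.1) := by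
    funext p
    ext i
    refine Fin.lastCases ?_ (fun j => ?_) i <;>
      simp [joinLast, MeasurableEquiv.piFinSuccAbove, Fin.insertNthEquiv]
  rw [h4]
  exact h3

end JoinLast

/-! ### The gauge along vertical lines -/

section Gauge

variable {d : ℕ} {K : Set (EuclideanSpace ℝ (Fin (d + 1)))}

theorem IsConvexBody.mem_nhds_zero {n : ℕ} {K : Set (EuclideanSpace ℝ (Fin n))}
    (hK : IsConvexBody K) (hKo : IsOriginSymmetric K) : K ∈ nhds 0 := by
  obtain ⟨x, hx⟩ := hK.2.2
  rw [← mem_interior_iff_mem_nhds]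
  have := hK.2.1.combo_interior_self_mem_interior hx (hKo x (interior_subset hx))
    (a := 1 / 2) (b := 1 / 2) (by norm_num) (by norm_num) (by norm_num)
  simpa using this

theorem IsConvexBody.exists_norm_le_mul_gauge {n : ℕ} {K : Set (EuclideanSpace ℝ (Fin n))}
    (hK : IsConvexBody K) (hKo : IsOriginSymmetric K) :
    ∃ R : ℝ, 0 < R ∧ ∀ x, ‖x‖ ≤ R * gauge K x := by
  obtain ⟨R, hR, hKR⟩ := hK.1.isBounded.subset_closedBall_lt 0 0
  refine ⟨R, hR, fun x => ?_⟩
  have := le_gauge_of_subset_closedBall (x := x)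
    (absorbent_nhds_zero (𝕜 := ℝ) (hK.mem_nhds_zero hKo)) hR.le hKR
  rwa [div_le_iff₀' hR] at this

theorem gauge_joinLast_neg (hKl : IsSymmetricLast K) (x : EuclideanSpace ℝ (Fin d)) (t : ℝ) :
    gauge K (joinLast x (-t)) = gauge K (joinLast x t) := by
  have key : ∀ r : ℝ, r⁻¹ • joinLast x (-t) ∈ K ↔ r⁻¹ • joinLast x t ∈ K := by
    intro r
    rw [smul_joinLast, smul_joinLast, mul_neg]
    exact ⟨fun h => by simpa using hKl _ _ h, fun h => hKl _ _ h⟩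
  simp only [gauge_def', key]

/-- For `|t| ≤ u` this is a convex combination of two mirror points of equal gauge, so (strict)
convexity yields (strict) monotonicity in the height. -/
theorem joinLast_eq_combo {t u : ℝ} (hu : u ≠ 0) (x : EuclideanSpace ℝ (Fin d)) :
    joinLast x t = ((u + t) / (2 * u)) • joinLast x u + ((u - t) / (2 * u)) • joinLast x (-u) := by
  rw [smul_joinLast, smul_joinLast, joinLast_add_joinLast, ← add_smul]
  congr 1
  · rw [← add_div, show u + t + (u - t) = 2 * u by ring, div_self (by positivity), one_smul]
  · field_simp
    ring

theorem gauge_joinLast_mono (hK : IsConvexBody K) (hKo : IsOriginSymmetric K)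
    (hKl : IsSymmetricLast K) (x : EuclideanSpace ℝ (Fin d)) {t u : ℝ} (h : |t| ≤ |u|) :
    gauge K (joinLast x t) ≤ gauge K (joinLast x u) := by
  have habs : gauge K (joinLast x |u|) = gauge K (joinLast x u) := by
    rcases abs_choice u with h | h <;> rw [h]
    exact gauge_joinLast_neg hKl x u
  rw [← habs]
  rcases eq_or_ne u 0 with rfl | hu
  · have : t = 0 := by simpa using h
    simp [this]
  set v := |u| with hv
  have hv0 : 0 < v := abs_pos.2 hu
  have h1 : 0 ≤ (v + t) / (2 * v) := div_nonneg (by linarith [(abs_le.1 h).1]) (by positivity)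
  have h2 : 0 ≤ (v - t) / (2 * v) := div_nonneg (by linarith [(abs_le.1 h).2]) (by positivity)
  rw [joinLast_eq_combo hv0.ne' x (t := t)]
  refine (gauge_add_le hK.2.1 (absorbent_nhds_zero (hK.mem_nhds_zero hKo)) _ _).trans_eq ?_
  rw [gauge_smul_of_nonneg h1, gauge_smul_of_nonneg h2, gauge_joinLast_neg hKl, ← add_smul,
    ← add_div, show v + t + (v - t) = 2 * v by ring, div_self (by positivity), one_smul]

theorem gauge_joinLast_lt (hK : IsConvexBody K) (hKo : IsOriginSymmetric K)
    (hKl : IsSymmetricLast K) (hKs : StrictConvex ℝ K) (x : EuclideanSpace ℝ (Fin d)) {t u : ℝ}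
    (h : |t| < u) : gauge K (joinLast x t) < gauge K (joinLast x u) := by
  have hu : 0 < u := (abs_nonneg t).trans_lt h
  have hn := hK.mem_nhds_zero hKo
  obtain ⟨R, hR, hKR⟩ := hK.exists_norm_le_mul_gauge hKo
  have hne : ∀ v : ℝ, v ≠ 0 → joinLast x v ≠ 0 := fun v hv h0 => hv (by
    rw [← joinLast_last x v, h0]; rfl)
  set g := gauge K (joinLast x u) with hg
  have hg0 : 0 < g := by
    have := hKR (joinLast x u)
    have h2 := norm_pos_iff.2 (hne u hu.ne')
    by_contra! h3
    nlinarith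
  have hmem : ∀ v : ℝ, gauge K (joinLast x v) = g → g⁻¹ • joinLast x v ∈ K := by
    intro v hv
    rw [← hK.1.isClosed.closure_eq, ← gauge_le_one_iff_mem_closure hK.2.1 hn,
      gauge_smul_of_nonneg (inv_nonneg.2 hg0.le), hv, smul_eq_mul, inv_mul_cancel₀ hg0.ne']
  have hint := hKs (hmem u rfl) (hmem (-u) (gauge_joinLast_neg hKl x u)) (by
      rw [Ne, smul_right_inj (inv_ne_zero hg0.ne')]
      intro h0
      have := congrArg (fun z => z (Fin.last d)) h0
      simp only [joinLast_last] at this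
      linarith)
    (a := (u + t) / (2 * u)) (b := (u - t) / (2 * u))
    (div_pos (by linarith [(abs_lt.1 h).1]) (by positivity))
    (div_pos (by linarith [(abs_lt.1 h).2]) (by positivity))
    (by rw [← add_div, show u + t + (u - t) = 2 * u by ring, div_self (by positivity)])
  have hlt := interior_subset_gauge_lt_one K hint
  rw [smul_comm, smul_comm _ g⁻¹, ← smul_add, ← joinLast_eq_combo hu.ne'] at hlt
  change gauge K _ < 1 at hlt
  rwa [gauge_smul_of_nonneg (inv_nonneg.2 hg0.le), smul_eq_mul, inv_mul_lt_one₀ hg0] at hlt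

theorem exists_gauge_joinLast_lt_iff (hK : IsConvexBody K) (hKo : IsOriginSymmetric K)
    (hKl : IsSymmetricLast K) (x : EuclideanSpace ℝ (Fin d)) (r : ℝ) :
    ∃ l : ℝ, 0 ≤ l ∧ {t : ℝ | gauge K (joinLast x t) < r} = Set.Ioo (-l) l := by
  obtain ⟨R, hR, hKR⟩ := hK.exists_norm_le_mul_gauge hKo
  have hcont : Continuous fun t : ℝ => gauge K (joinLast x t) :=
    (continuous_gauge hK.2.1 (hK.mem_nhds_zero hKo)).comp
      (continuous_joinLast.comp (Continuous.prodMk_right x))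
  -- The half-length is the first height where the gauge reaches `r`; for `r ≤ 0` it is `0` and the
  -- interval is empty.
  set C : Set ℝ := {t | 0 ≤ t ∧ r ≤ gauge K (joinLast x t)} with hC
  have hCc : IsClosed C := (isClosed_le continuous_const continuous_id).inter
    (isClosed_le continuous_const hcont)
  have hCb : BddBelow C := ⟨0, fun t ht => ht.1⟩
  have hCn : C.Nonempty := by
    refine ⟨R * |r|, by positivity, ?_⟩
    have h1 := hKR (joinLast x (R * |r|))
    have h2 := PiLp.norm_apply_le (joinLast x (R * |r|)) (Fin.last d)
    rw [joinLast_last, Real.norm_eq_abs, abs_mul, abs_of_pos hR, abs_abs] at h2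
    exact (le_abs_self r).trans (le_of_mul_le_mul_left (h2.trans h1) hR)
  have hl := hCc.csInf_mem hCn hCb
  refine ⟨sInf C, hl.1, ?_⟩
  ext t
  rw [Set.mem_Ioo, ← abs_lt]
  constructor
  · intro ht
    by_contra! h
    have := gauge_joinLast_mono hK hKo hKl x (t := sInf C) (u := t) (by rwa [abs_of_nonneg hl.1])
    exact absurd ht (not_lt.2 (hl.2.trans this))
  · intro ht
    have : |t| ∉ C := fun h => absurd (csInf_le hCb h) (not_le.2 ht)
    have h2 : gauge K (joinLast x |t|) < r := by
      by_contra! h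
      exact this ⟨abs_nonneg t, h⟩
    exact (gauge_joinLast_mono hK hKo hKl x (by rw [abs_abs])).trans_lt h2

end Gauge

theorem measurePreserving_prod_prod_prod_comm {α β γ δ : Type*} [MeasureSpace α] [MeasureSpace β]
    [MeasureSpace γ] [MeasureSpace δ] [SigmaFinite (volume : Measure α)]
    [SigmaFinite (volume : Measure β)] [SigmaFinite (volume : Measure γ)]
    [SigmaFinite (volume : Measure δ)] :
    MeasurePreserving (fun q : (α × β) × (γ × δ) => ((q.1.1, q.2.1), (q.1.2, q.2.2))) := by
  have h1 : MeasurePreserving (MeasurableEquiv.prodAssoc : (α × β) × (γ × δ) ≃ᵐ _) :=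
    measurePreserving_prodAssoc volume volume volume
  have h2 : MeasurePreserving (MeasurableEquiv.prodAssoc : (β × γ) × δ ≃ᵐ _).symm :=
    (measurePreserving_prodAssoc volume volume volume).symm
  have h3 : MeasurePreserving (fun q : (β × γ) × δ => (q.1.swap, q.2)) volume
      (volume : Measure ((γ × β) × δ)) :=
    (Measure.measurePreserving_swap (μ := (volume : Measure β))
      (ν := (volume : Measure γ))).prod (MeasurePreserving.id (volume : Measure δ))
  have h4 : MeasurePreserving (MeasurableEquiv.prodAssoc : (γ × β) × δ ≃ᵐ _) :=
    measurePreserving_prodAssoc volume volume volume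
  have h5 : MeasurePreserving (MeasurableEquiv.prodAssoc : (α × γ) × (β × δ) ≃ᵐ _).symm :=
    (measurePreserving_prodAssoc volume volume volume).symm
  exact h5.comp (((MeasurePreserving.id (volume : Measure α)).prod
    (h4.comp (h3.comp h2))).comp h1)

/-! ### Counting pairs with difference in a given set -/

section PairMeasure

variable {G : Type*} [AddCommGroup G] [MeasureSpace G]

/-- The measure of the set of pairs `(x, y) ∈ E × F` with `x - y ∈ D`. -/
noncomputable def pairMeasure (D E F : Set G) : ℝ≥0∞ :=
  volume ((E ×ˢ F) ∩ {p : G × G | p.1 - p.2 ∈ D})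

theorem pairMeasure_mono {D D' : Set G} (h : D ⊆ D') (E F : Set G) :
    pairMeasure D E F ≤ pairMeasure D' E F :=
  measure_mono (Set.inter_subset_inter_right _ fun _ hp => h hp)

theorem pairMeasure_compl_add [MeasurableAdd₂ G] [MeasurableNeg G]
    [SigmaFinite (volume : Measure G)] [(volume : Measure G).IsAddLeftInvariant]
    {D E : Set G} (hD : MeasurableSet D) (hE : MeasurableSet E) (hneg : -D = D) :
    pairMeasure D E Eᶜ + pairMeasure D E E = volume E * volume D := by
  have hDm : MeasurableSet {p : G × G | p.1 - p.2 ∈ D} := (measurable_fst.sub measurable_snd) hD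
  have h1 : volume ((E ×ˢ Set.univ) ∩ {p : G × G | p.1 - p.2 ∈ D}) = volume E * volume D := by
    rw [Measure.volume_eq_prod, Measure.prod_apply ((hE.prod .univ).inter hDm)]
    have : ∀ x, volume (Prod.mk x ⁻¹' ((E ×ˢ Set.univ) ∩ {p : G × G | p.1 - p.2 ∈ D})) =
        E.indicator (fun _ => volume D) x := by
      intro x
      by_cases hx : x ∈ E
      · rw [Set.indicator_of_mem hx, ← measure_preimage_add volume (-x) D]
        congr 1
        ext y
        have : x - y ∈ D ↔ -x + y ∈ D := by
          rw [← Set.neg_mem_neg, hneg, neg_sub, sub_eq_neg_add]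
        simp [hx, this]
      · rw [Set.indicator_of_notMem hx]
        convert measure_empty (μ := (volume : Measure G))
        ext y
        simp [hx]
    simp_rw [this]
    rw [lintegral_indicator_const hE, mul_comm]
  rw [← h1, pairMeasure, pairMeasure, ← measure_union _ ((hE.prod hE).inter hDm)]
  · rw [← Set.union_inter_distrib_right, ← Set.prod_union, Set.compl_union_self]
  · exact ((Set.disjoint_prod.2 (Or.inr disjoint_compl_left)).mono Set.inter_subset_left
      Set.inter_subset_left)

end PairMeasure

/-! ### Fubini over sections -/

section Sections

variable {d : ℕ} {E D : Set (EuclideanSpace ℝ (Fin (d + 1)))}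

theorem measurableSet_preimage_joinLast (hE : MeasurableSet E) :
    MeasurableSet {p : EuclideanSpace ℝ (Fin d) × ℝ | joinLast p.1 p.2 ∈ E} :=
  measurePreserving_joinLast.measurable hE

theorem measurableSet_lastSection (hE : MeasurableSet E) (x : EuclideanSpace ℝ (Fin d)) :
    MeasurableSet (lastSection E x) :=
  measurable_prodMk_left (measurableSet_preimage_joinLast hE)

theorem measurable_volume_lastSection (hE : MeasurableSet E) :
    Measurable fun x => volume (lastSection E x) :=
  measurable_measure_prodMk_left (measurableSet_preimage_joinLast hE)

theorem volume_eq_lintegral_lastSection (hE : MeasurableSet E) :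
    volume E = ∫⁻ x, volume (lastSection E x) := by
  rw [← measurePreserving_joinLast.measure_preimage hE.nullMeasurableSet]
  exact Measure.prod_apply (measurableSet_preimage_joinLast hE)

theorem ae_volume_lastSection_ne_top (hE : MeasurableSet E) (hEf : volume E < ∞) :
    ∀ᵐ x, volume (lastSection E x) ≠ ∞ := by
  rw [volume_eq_lintegral_lastSection hE] at hEf
  filter_upwards [ae_lt_top (measurable_volume_lastSection hE) hEf.ne] with x hx using hx.ne

theorem measurable_dropLast :
    Measurable (dropLast : EuclideanSpace ℝ (Fin (d + 1)) → EuclideanSpace ℝ (Fin d)) :=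
  ((PiLp.continuous_toLp 2 _).comp (by fun_prop)).measurable

theorem measurableSet_steinerSymm (hE : MeasurableSet E) : MeasurableSet (steinerSymm E) := by
  have hm : Measurable fun x => volume (lastSection E (dropLast x)) :=
    (measurable_volume_lastSection hE).comp measurable_dropLast
  have : steinerSymm E = {x | volume (lastSection E (dropLast x)) = ∞} ∪
      ({x | volume (lastSection E (dropLast x)) = ∞}ᶜ ∩
        {x | |x (Fin.last d)| ≤ (volume (lastSection E (dropLast x))).toReal / 2}) := by
    ext x
    by_cases h : volume (lastSection E (dropLast x)) = ∞ <;>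
      simp [steinerSymm, schwarzSymm, h]
  rw [this]
  have h1 : MeasurableSet {x | volume (lastSection E (dropLast x)) = ∞} :=
    hm (measurableSet_singleton ∞)
  refine h1.union (h1.compl.inter (measurableSet_le ?_ (hm.ennreal_toReal.div_const 2)))
  exact (by fun_prop : Continuous fun x : EuclideanSpace ℝ (Fin (d + 1)) =>
    |x (Fin.last d)|).measurable

theorem volume_steinerSymm (hE : MeasurableSet E) : volume (steinerSymm E) = volume E := by
  rw [volume_eq_lintegral_lastSection hE,
    volume_eq_lintegral_lastSection (measurableSet_steinerSymm hE)]
  simp_rw [lastSection_steinerSymm, volume_schwarzSymm]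

theorem ae_eq_of_ae_lastSection_ae_eq {F : Set (EuclideanSpace ℝ (Fin (d + 1)))}
    (hE : MeasurableSet E) (hF : MeasurableSet F)
    (h : ∀ᵐ x, lastSection E x =ᵐ[volume] lastSection F x) : E =ᵐ[volume] F := by
  rw [← measure_symmDiff_eq_zero_iff,
    volume_eq_lintegral_lastSection (hE.symmDiff hF), lintegral_eq_zero_iff
      (measurable_volume_lastSection (hE.symmDiff hF))]
  filter_upwards [h] with x hx
  exact measure_symmDiff_eq_zero_iff.2 hx

theorem measurableSet_joinLast_pairs (hE : MeasurableSet E) (hD : MeasurableSet D) :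
    MeasurableSet {q : (EuclideanSpace ℝ (Fin d) × EuclideanSpace ℝ (Fin d)) × (ℝ × ℝ) |
      (joinLast q.1.1 q.2.1 ∈ E ∧ joinLast q.1.2 q.2.2 ∈ E) ∧
        joinLast q.1.1 q.2.1 - joinLast q.1.2 q.2.2 ∈ D} := by
  have hj := (measurePreserving_joinLast (d := d)).measurable
  have h1 : Measurable fun q : (EuclideanSpace ℝ (Fin d) × EuclideanSpace ℝ (Fin d)) × (ℝ × ℝ) =>
      joinLast q.1.1 q.2.1 := hj.comp (measurable_fst.fst.prodMk measurable_snd.fst)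
  have h2 : Measurable fun q : (EuclideanSpace ℝ (Fin d) × EuclideanSpace ℝ (Fin d)) × (ℝ × ℝ) =>
      joinLast q.1.2 q.2.2 := hj.comp (measurable_fst.snd.prodMk measurable_snd.snd)
  exact ((h1 hE).inter (h2 hE)).inter ((h1.sub h2) hD)

theorem overlap_lastSection (p : EuclideanSpace ℝ (Fin d) × EuclideanSpace ℝ (Fin d)) :
    overlap (lastSection E p.1) (lastSection E p.2) (lastSection D (p.1 - p.2)) =
      volume (Prod.mk p ⁻¹' {q : (EuclideanSpace ℝ (Fin d) × EuclideanSpace ℝ (Fin d)) × (ℝ × ℝ) |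
      (joinLast q.1.1 q.2.1 ∈ E ∧ joinLast q.1.2 q.2.2 ∈ E) ∧
        joinLast q.1.1 q.2.1 - joinLast q.1.2 q.2.2 ∈ D}) := by
  unfold overlap
  congr 1
  ext q
  simp [lastSection, joinLast_sub_joinLast]

theorem measurable_overlap_lastSection (hE : MeasurableSet E) (hD : MeasurableSet D) :
    Measurable fun p : EuclideanSpace ℝ (Fin d) × EuclideanSpace ℝ (Fin d) =>
      overlap (lastSection E p.1) (lastSection E p.2) (lastSection D (p.1 - p.2)) := by
  simp_rw [overlap_lastSection]
  exact measurable_measure_prodMk_left (measurableSet_joinLast_pairs hE hD)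

theorem pairMeasure_eq_lintegral_overlap (hE : MeasurableSet E) (hD : MeasurableSet D) :
    pairMeasure D E E = ∫⁻ p : EuclideanSpace ℝ (Fin d) × EuclideanSpace ℝ (Fin d),
      overlap (lastSection E p.1) (lastSection E p.2) (lastSection D (p.1 - p.2)) := by
  simp_rw [overlap_lastSection]
  have h1 := ((measurePreserving_joinLast (d := d)).prod (measurePreserving_joinLast (d := d))).comp
    (measurePreserving_prod_prod_prod_comm (α := EuclideanSpace ℝ (Fin d))
      (β := EuclideanSpace ℝ (Fin d)) (γ := ℝ) (δ := ℝ))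
  have hm : MeasurableSet ((E ×ˢ E) ∩
      {p : EuclideanSpace ℝ (Fin (d + 1)) × EuclideanSpace ℝ (Fin (d + 1)) | p.1 - p.2 ∈ D}) :=
    (hE.prod hE).inter ((measurable_fst.sub measurable_snd) hD)
  rw [pairMeasure, Measure.volume_eq_prod, ← h1.measure_preimage hm.nullMeasurableSet,
    ← Measure.prod_apply (measurableSet_joinLast_pairs hE hD)]
  rfl

end Sections

/-! ### Layer-cake formula and invariances of the perimeter -/

section LayerCake

variable {n : ℕ} {K E : Set (EuclideanSpace ℝ (Fin n))}

theorem lt_one_div_rpow_iff {q g ρ : ℝ} (hq : 0 < q) (hg : 0 < g) (hρ : 0 < ρ) :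
    ρ < 1 / g ^ q ↔ g < (1 / ρ) ^ (1 / q) := by
  rw [one_div q, Real.lt_rpow_inv_iff_of_pos hg.le (by positivity) hq,
    lt_one_div hρ (by positivity)]

theorem measurableSet_gauge_lt (hK : IsConvexBody K) (hKo : IsOriginSymmetric K) (r : ℝ) :
    MeasurableSet {x | gauge K x < r} :=
  (isOpen_lt (continuous_gauge hK.2.1 (hK.mem_nhds_zero hKo)) continuous_const).measurableSet

theorem volume_gauge_lt_ne_top (hK : IsConvexBody K) (hKo : IsOriginSymmetric K) (r : ℝ) :
    volume {x | gauge K x < r} ≠ ∞ := by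
  obtain ⟨R, hR, hKR⟩ := hK.exists_norm_le_mul_gauge hKo
  have hsub : {x | gauge K x < r} ⊆ Metric.closedBall 0 (R * r) := fun x hx => by
    rw [mem_closedBall_zero_iff]
    exact (hKR x).trans (mul_le_mul_of_nonneg_left (le_of_lt hx) hR.le)
  exact measure_ne_top_of_subset hsub measure_closedBall_lt_top.ne

theorem fracPerimeter_eq_lintegral_pairMeasure {s : ℝ} (hs : 0 < s) (hK : IsConvexBody K)
    (hKo : IsOriginSymmetric K) (hE : MeasurableSet E) :
    fracPerimeter s E K = ∫⁻ ρ in Set.Ioi (0 : ℝ),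
      pairMeasure {x | gauge K x < (1 / ρ) ^ (1 / ((n : ℝ) + s))} E Eᶜ := by
  have hq : 0 < (n : ℝ) + s := by positivity
  obtain ⟨R, hR, hKR⟩ := hK.exists_norm_le_mul_gauge hKo
  have hgm : Measurable (gauge K) := (continuous_gauge hK.2.1 (hK.mem_nhds_zero hKo)).measurable
  have hfm : Measurable fun p : EuclideanSpace ℝ (Fin n) × EuclideanSpace ℝ (Fin n) =>
      1 / gauge K (p.1 - p.2) ^ ((n : ℝ) + s) :=
    ((hgm.comp (measurable_fst.sub measurable_snd)).pow_const _).const_div 1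
  rw [fracPerimeter, ← lintegral_prod (fun p => ENNReal.ofReal
    (1 / gauge K (p.1 - p.2) ^ ((n : ℝ) + s))) hfm.ennreal_ofReal.aemeasurable,
    lintegral_eq_lintegral_meas_lt _ (Filter.Eventually.of_forall fun p => ?_) hfm.aemeasurable]
  · refine setLIntegral_congr_fun measurableSet_Ioi fun ρ hρ => ?_
    rw [Measure.prod_restrict, Measure.restrict_apply' (hE.prod hE.compl), pairMeasure,
      Set.inter_comm, Measure.volume_eq_prod]
    congr 1
    ext ⟨x, y⟩
    simp only [Set.mem_inter_iff, Set.mem_prod, Set.mem_ofPred_eq]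
    refine and_congr_right fun ⟨hx, hy⟩ => lt_one_div_rpow_iff hq ?_ hρ
    -- Off the diagonal the gauge is positive; at gauge `0` the convention `1 / 0 = 0` would break
    -- the level-set equivalence.
    have hne : x - y ≠ 0 := fun h => hy (by rwa [← sub_eq_zero.1 h])
    have := (norm_pos_iff.2 hne).trans_le (hKR _)
    exact pos_of_mul_pos_right this hR.le
  · exact div_nonneg zero_le_one (Real.rpow_nonneg (gauge_nonneg _) _)

theorem fracPerimeter_congr_ae {F : Set (EuclideanSpace ℝ (Fin n))} (s : ℝ)
    (h : E =ᵐ[volume] F) : fracPerimeter s E K = fracPerimeter s F K := by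
  rw [fracPerimeter, fracPerimeter, Measure.restrict_congr_set h, Measure.restrict_congr_set h.compl]

theorem fracPerimeter_image_add_right (s : ℝ) (v : EuclideanSpace ℝ (Fin n)) :
    fracPerimeter s ((fun x => x + v) '' E) K = fracPerimeter s E K := by
  have hp := measurePreserving_add_right (volume : Measure (EuclideanSpace ℝ (Fin n))) v
  have he : MeasurableEmbedding fun x : EuclideanSpace ℝ (Fin n) => x + v :=
    measurableEmbedding_addRight v
  have hb : Function.Bijective fun x : EuclideanSpace ℝ (Fin n) => x + v :=
    (Equiv.addRight v).bijective
  rw [fracPerimeter, fracPerimeter, ← Set.image_compl_eq hb, ← hp.setLIntegral_comp_emb he]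
  simp_rw [← hp.setLIntegral_comp_emb he, add_sub_add_right_eq_sub]

end LayerCake

/-! ### The inequality and its equality case -/

section Steiner

variable {d : ℕ} {K E : Set (EuclideanSpace ℝ (Fin (d + 1)))}

theorem overlap_lastSection_le_steinerSymm (hK : IsConvexBody K) (hKo : IsOriginSymmetric K)
    (hKl : IsSymmetricLast K) (hE : MeasurableSet E) (hEf : volume E < ∞) (r : ℝ) :
    ∀ᵐ p : EuclideanSpace ℝ (Fin d) × EuclideanSpace ℝ (Fin d),
      overlap (lastSection E p.1) (lastSection E p.2)
        (lastSection {x | gauge K x < r} (p.1 - p.2)) ≤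
      overlap (lastSection (steinerSymm E) p.1) (lastSection (steinerSymm E) p.2)
        (lastSection {x | gauge K x < r} (p.1 - p.2)) := by
  have hf := ae_volume_lastSection_ne_top hE hEf
  filter_upwards [Measure.quasiMeasurePreserving_fst.ae hf,
    Measure.quasiMeasurePreserving_snd.ae hf] with p h1 h2
  obtain ⟨l, hl, hS⟩ := exists_gauge_joinLast_lt_iff hK hKo hKl (p.1 - p.2) r
  have hS' : lastSection {x | gauge K x < r} (p.1 - p.2) = Set.Ioo (-l) l := hS
  rw [hS', lastSection_steinerSymm, lastSection_steinerSymm]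
  exact overlap_le_overlap_schwarzSymm (measurableSet_lastSection hE _)
    (measurableSet_lastSection hE _) h1 h2 hl

theorem pairMeasure_le_steinerSymm (hK : IsConvexBody K) (hKo : IsOriginSymmetric K)
    (hKl : IsSymmetricLast K) (hE : MeasurableSet E) (hEf : volume E < ∞) (r : ℝ) :
    pairMeasure {x | gauge K x < r} E E ≤
      pairMeasure {x | gauge K x < r} (steinerSymm E) (steinerSymm E) := by
  rw [pairMeasure_eq_lintegral_overlap hE (measurableSet_gauge_lt hK hKo r),
    pairMeasure_eq_lintegral_overlap (measurableSet_steinerSymm hE)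
      (measurableSet_gauge_lt hK hKo r)]
  exact lintegral_mono_ae (overlap_lastSection_le_steinerSymm hK hKo hKl hE hEf r)

theorem pairMeasure_gauge_compl_add (hK : IsConvexBody K) (hKo : IsOriginSymmetric K)
    {F : Set (EuclideanSpace ℝ (Fin (d + 1)))} (hF : MeasurableSet F) (r : ℝ) :
    pairMeasure {x | gauge K x < r} F Fᶜ + pairMeasure {x | gauge K x < r} F F =
      volume F * volume {x | gauge K x < r} := by
  refine pairMeasure_compl_add (measurableSet_gauge_lt hK hKo r) hF ?_
  ext x
  simp [gauge_neg hKo]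

theorem pairMeasure_gauge_ne_top (hK : IsConvexBody K) (hKo : IsOriginSymmetric K)
    {F : Set (EuclideanSpace ℝ (Fin (d + 1)))} (hF : MeasurableSet F) (hFf : volume F < ∞)
    (r : ℝ) : pairMeasure {x | gauge K x < r} F F ≠ ∞ :=
  ne_top_of_le_ne_top (ENNReal.mul_ne_top hFf.ne (volume_gauge_lt_ne_top hK hKo r))
    (le_add_self.trans_eq (pairMeasure_gauge_compl_add hK hKo hF r))

theorem pairMeasure_steinerSymm_compl_le (hK : IsConvexBody K) (hKo : IsOriginSymmetric K)
    (hKl : IsSymmetricLast K) (hE : MeasurableSet E) (hEf : volume E < ∞) (r : ℝ) :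
    pairMeasure {x | gauge K x < r} (steinerSymm E) (steinerSymm E)ᶜ ≤
      pairMeasure {x | gauge K x < r} E Eᶜ := by
  have h1 := pairMeasure_gauge_compl_add hK hKo hE r
  have h2 := pairMeasure_gauge_compl_add hK hKo (measurableSet_steinerSymm hE) r
  rw [volume_steinerSymm hE, ← h1] at h2
  have h3 := pairMeasure_le_steinerSymm hK hKo hKl hE hEf r
  by_contra! hlt
  exact (ENNReal.add_lt_add_of_lt_of_le (pairMeasure_gauge_ne_top hK hKo hE hEf r) hlt h3).ne'
    h2

theorem fracPerimeter_steinerSymm_le {s : ℝ} (hs : 0 < s) (hK : IsConvexBody K)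
    (hKo : IsOriginSymmetric K) (hKl : IsSymmetricLast K) (hE : MeasurableSet E)
    (hEf : volume E < ∞) : fracPerimeter s (steinerSymm E) K ≤ fracPerimeter s E K := by
  rw [fracPerimeter_eq_lintegral_pairMeasure hs hK hKo hE,
    fracPerimeter_eq_lintegral_pairMeasure hs hK hKo (measurableSet_steinerSymm hE)]
  exact lintegral_mono fun ρ => pairMeasure_steinerSymm_compl_le hK hKo hKl hE hEf _

theorem ae_pairMeasure_eq_of_fracPerimeter_eq {s : ℝ} (hs : 0 < s) (hK : IsConvexBody K)
    (hKo : IsOriginSymmetric K) (hKl : IsSymmetricLast K) (hE : MeasurableSet E)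
    (hEf : volume E < ∞) (hP : fracPerimeter s E K < ∞)
    (heq : fracPerimeter s E K = fracPerimeter s (steinerSymm E) K) :
    ∀ᵐ ρ ∂volume.restrict (Set.Ioi (0 : ℝ)),
      pairMeasure {x | gauge K x < (1 / ρ) ^ (1 / (((d + 1 : ℕ) : ℝ) + s))} E E =
        pairMeasure {x | gauge K x < (1 / ρ) ^ (1 / (((d + 1 : ℕ) : ℝ) + s))}
          (steinerSymm E) (steinerSymm E) := by
  have hE' := measurableSet_steinerSymm hE
  have hfin : fracPerimeter s (steinerSymm E) K ≠ ∞ := heq ▸ hP.ne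
  rw [fracPerimeter_eq_lintegral_pairMeasure hs hK hKo hE] at heq
  rw [fracPerimeter_eq_lintegral_pairMeasure hs hK hKo hE'] at heq hfin
  -- The gauge balls shrink as `ρ` grows, so measurability in `ρ` comes from monotonicity.
  have hmeas : AEMeasurable (fun ρ : ℝ =>
      pairMeasure {x | gauge K x < (1 / ρ) ^ (1 / (((d + 1 : ℕ) : ℝ) + s))} E Eᶜ)
      (volume.restrict (Set.Ioi (0 : ℝ))) := by
    refine aemeasurable_restrict_of_antitoneOn measurableSet_Ioi fun a ha b hb hab => ?_
    have ha' : 0 < a := ha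
    have hle : (1 / b) ^ (1 / (((d + 1 : ℕ) : ℝ) + s)) ≤ (1 / a) ^ (1 / (((d + 1 : ℕ) : ℝ) + s)) :=
      Real.rpow_le_rpow (one_div_nonneg.2 (le_of_lt hb)) (one_div_le_one_div_of_le ha' hab)
        (by positivity)
    exact pairMeasure_mono (fun x (hx : gauge K x < _) => hx.trans_le hle) _ _
  filter_upwards [ae_eq_of_ae_le_of_lintegral_le (Filter.Eventually.of_forall fun ρ =>
    pairMeasure_steinerSymm_compl_le hK hKo hKl hE hEf _) hfin hmeas heq.le] with ρ hρ
  have h1 := pairMeasure_gauge_compl_add hK hKo hE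
    ((1 / ρ) ^ (1 / (((d + 1 : ℕ) : ℝ) + s)))
  have h2 := pairMeasure_gauge_compl_add hK hKo hE'
    ((1 / ρ) ^ (1 / (((d + 1 : ℕ) : ℝ) + s)))
  rw [volume_steinerSymm hE, ← h1, hρ] at h2
  refine ((ENNReal.add_right_inj ?_).1 h2).symm
  refine ne_top_of_le_ne_top (ENNReal.mul_ne_top hEf.ne (volume_gauge_lt_ne_top hK hKo
    ((1 / ρ) ^ (1 / (((d + 1 : ℕ) : ℝ) + s))))) (le_self_add.trans_eq h1)

theorem ae_overlap_eq_of_pairMeasure_eq (hK : IsConvexBody K) (hKo : IsOriginSymmetric K)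
    (hKl : IsSymmetricLast K) (hE : MeasurableSet E) (hEf : volume E < ∞) {r : ℝ}
    (h : pairMeasure {x | gauge K x < r} E E =
      pairMeasure {x | gauge K x < r} (steinerSymm E) (steinerSymm E)) :
    ∀ᵐ p : EuclideanSpace ℝ (Fin d) × EuclideanSpace ℝ (Fin d),
      overlap (lastSection E p.1) (lastSection E p.2)
        (lastSection {x | gauge K x < r} (p.1 - p.2)) =
      overlap (schwarzSymm (lastSection E p.1)) (schwarzSymm (lastSection E p.2))
        (lastSection {x | gauge K x < r} (p.1 - p.2)) := by
  have hE' := measurableSet_steinerSymm hE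
  have hD := measurableSet_gauge_lt hK hKo r
  have hfin := pairMeasure_gauge_ne_top hK hKo hE hEf r
  rw [pairMeasure_eq_lintegral_overlap hE hD] at h hfin
  rw [pairMeasure_eq_lintegral_overlap hE' hD] at h
  simp_rw [← lastSection_steinerSymm]
  exact ae_eq_of_ae_le_of_lintegral_le (overlap_lastSection_le_steinerSymm hK hKo hKl hE hEf r)
    hfin (measurable_overlap_lastSection hE' hD).aemeasurable h.ge

/-- All differences of the symmetrized sets lie in the interval `hsub` places inside `S`, so their
overlap is `|A| |B|`. Equality then leaves no room in `A × B` for a non-null set of pairs outside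
`S`. -/
theorem ae_sub_mem_of_overlap_eq {A B S : Set ℝ} (hA : MeasurableSet A) (hB : MeasurableSet B)
    (hS : MeasurableSet S) (hAf : volume A ≠ ∞) (hBf : volume B ≠ ∞)
    (hsub : Set.Icc (-(((volume A).toReal + (volume B).toReal) / 2))
      (((volume A).toReal + (volume B).toReal) / 2) ⊆ S)
    (h : overlap A B S = overlap (schwarzSymm A) (schwarzSymm B) S) :
    ∀ᵐ p ∂((volume.restrict A).prod (volume.restrict B)), p.1 - p.2 ∈ S := by
  have h1 : overlap (schwarzSymm A) (schwarzSymm B) S = volume A * volume B := by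
    rw [← volume_schwarzSymm A, ← volume_schwarzSymm B, ← Measure.prod_prod, overlap,
      Measure.volume_eq_prod, Set.inter_eq_left.2]
    rintro ⟨t, u⟩ ⟨ht, hu⟩
    rw [schwarzSymm, if_neg hAf, Real.closedBall_eq_Icc] at ht
    rw [schwarzSymm, if_neg hBf, Real.closedBall_eq_Icc] at hu
    simp only [Set.mem_Icc] at ht hu
    exact hsub ⟨by simp only; linarith [ht.1, hu.2], by simp only; linarith [ht.2, hu.1]⟩
  rw [Measure.prod_restrict, ae_restrict_iff' (hA.prod hB)]
  have h2 : ((A ×ˢ B) ∩ {p : ℝ × ℝ | p.1 - p.2 ∈ S} : Set (ℝ × ℝ))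
      =ᵐ[volume.prod volume] (A ×ˢ B : Set (ℝ × ℝ)) := by
    refine ae_eq_of_subset_of_measure_ge Set.inter_subset_left ?_
      ((hA.prod hB).inter (measurableSet_sub_mem hS)).nullMeasurableSet ?_
    · rw [Measure.prod_prod, ← h1, ← h]
      rfl
    · rw [Measure.prod_prod]
      exact ENNReal.mul_ne_top hAf hBf
  filter_upwards [h2.mem_iff] with p hp hm using (hp.2 hm).2

/-- For almost every pair of non-negligible sections of an extremal set, both sections are
intervals with the same centre. -/
theorem ae_lastSection_ae_eq_closedBall {s : ℝ} (hs : 0 < s) (hK : IsConvexBody K)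
    (hKo : IsOriginSymmetric K) (hKl : IsSymmetricLast K) (hKs : StrictConvex ℝ K)
    (hE : MeasurableSet E) (hEf : volume E < ∞) (hP : fracPerimeter s E K < ∞)
    (heq : fracPerimeter s E K = fracPerimeter s (steinerSymm E) K) :
    ∀ᵐ p : EuclideanSpace ℝ (Fin d) × EuclideanSpace ℝ (Fin d),
      volume (lastSection E p.1) ≠ 0 → volume (lastSection E p.2) ≠ 0 →
      lastSection E p.2 =ᵐ[volume] Metric.closedBall (essCenter (lastSection E p.1))
        ((volume (lastSection E p.2)).toReal / 2) := by
  have hq : 0 < ((d + 1 : ℕ) : ℝ) + s := by positivity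
  obtain ⟨R, hR, hKR⟩ := hK.exists_norm_le_mul_gauge hKo
  have hgood := ae_pairMeasure_eq_of_fracPerimeter_eq hs hK hKo hKl hE hEf hP heq
  rw [ae_restrict_iff' measurableSet_Ioi] at hgood
  -- A countable dense set of good levels gives one null set of exceptional pairs that serves all of
  -- its levels.
  obtain ⟨Q, hQ, hQc, hQd⟩ := (Measure.dense_of_ae hgood).exists_countable_dense_subset
  have hov : ∀ᵐ p : EuclideanSpace ℝ (Fin d) × EuclideanSpace ℝ (Fin d), ∀ ρ ∈ Q, 0 < ρ →
      overlap (lastSection E p.1) (lastSection E p.2) (lastSection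
        {x | gauge K x < (1 / ρ) ^ (1 / (((d + 1 : ℕ) : ℝ) + s))} (p.1 - p.2)) =
      overlap (schwarzSymm (lastSection E p.1)) (schwarzSymm (lastSection E p.2)) (lastSection
        {x | gauge K x < (1 / ρ) ^ (1 / (((d + 1 : ℕ) : ℝ) + s))} (p.1 - p.2)) := by
    refine (ae_ball_iff hQc).2 fun ρ hρ => ?_
    by_cases h0 : 0 < ρ
    · filter_upwards [ae_overlap_eq_of_pairMeasure_eq hK hKo hKl hE hEf (hQ hρ h0)]
        with p hp _ using hp
    · exact Filter.Eventually.of_forall fun p h => absurd h h0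
  have hf := ae_volume_lastSection_ne_top hE hEf
  filter_upwards [hov, Measure.quasiMeasurePreserving_fst.ae hf,
    Measure.quasiMeasurePreserving_snd.ae hf] with p hp hAf hBf hA0 hB0
  set A := lastSection E p.1 with hAdef
  set B := lastSection E p.2 with hBdef
  have hA : MeasurableSet A := measurableSet_lastSection hE _
  have hB : MeasurableSet B := measurableSet_lastSection hE _
  refine (ae_eq_closedBall_essCenter hA hB hAf hBf hA0 hB0 ?_).2
  set L := ((volume A).toReal + (volume B).toReal) / 2 with hL
  have hL0 : 0 < L := by
    have h1 := ENNReal.toReal_pos hA0 hAf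
    have h2 := ENNReal.toReal_pos hB0 hBf
    positivity
  have hpos : ∀ t : ℝ, 0 < t → 0 < gauge K (joinLast (p.1 - p.2) t) := by
    intro t ht
    have := hKR (joinLast (p.1 - p.2) t)
    refine pos_of_mul_pos_right ((norm_pos_iff.2 fun h0 => ht.ne' ?_).trans_le this) hR.le
    rw [← joinLast_last (p.1 - p.2) t, h0, PiLp.zero_apply]
  have hk : ∀ k : ℕ, ∀ᵐ q ∂((volume.restrict A).prod (volume.restrict B)),
      |q.1 - q.2| ≤ L + 1 / ((k : ℝ) + 1) := by
    intro k
    have hε : 0 < 1 / ((k : ℝ) + 1) := by positivity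
    set M := L + 1 / ((k : ℝ) + 1) with hM
    have hgL := hpos L hL0
    have hgM := hpos M (by positivity)
    have hlt : 1 / gauge K (joinLast (p.1 - p.2) M) ^ (((d + 1 : ℕ) : ℝ) + s) <
        1 / gauge K (joinLast (p.1 - p.2) L) ^ (((d + 1 : ℕ) : ℝ) + s) := by
      refine one_div_lt_one_div_of_lt (by positivity) (Real.rpow_lt_rpow hgL.le ?_ hq)
      exact gauge_joinLast_lt hK hKo hKl hKs _ (by rw [abs_of_pos hL0]; linarith)
    -- The gauge ball of this level contains height `L` but not height `M` over `p.1 - p.2`: its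
    -- section covers `[-L, L]` and stays within `(-M, M)`.
    obtain ⟨ρ, hρQ, hρ1, hρ2⟩ := hQd.exists_between hlt
    have hρ0 : 0 < ρ := lt_trans (by positivity) hρ1
    have hrL := (lt_one_div_rpow_iff hq hgL hρ0).1 hρ2
    have hrM := mt (lt_one_div_rpow_iff hq hgM hρ0).2 (not_lt.2 hρ1.le)
    have hmem := ae_sub_mem_of_overlap_eq hA hB
      (measurableSet_lastSection (measurableSet_gauge_lt hK hKo _) _) hAf hBf
      (fun t ht => lt_of_le_of_lt (gauge_joinLast_mono hK hKo hKl _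
        ((abs_le.2 ht).trans (le_abs_self _))) hrL) (hp ρ hρQ hρ0)
    filter_upwards [hmem] with z hz
    by_contra! h
    refine hrM (lt_of_le_of_lt (gauge_joinLast_mono hK hKo hKl _ ?_) hz)
    rw [abs_of_pos (by positivity : 0 < M)]
    exact h.le
  filter_upwards [ae_all_iff.2 hk] with z hz
  refine ge_of_tendsto' (x := Filter.atTop) (f := fun k : ℕ => L + 1 / ((k : ℝ) + 1)) ?_ hz
  simpa using tendsto_one_div_add_atTop_nhds_zero_nat.const_add L

theorem lastSection_image_add_joinLast_zero (c : ℝ) (x : EuclideanSpace ℝ (Fin d)) :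
    lastSection ((fun y => y + joinLast 0 c) '' E) x = (fun t => t + c) '' lastSection E x := by
  ext t
  rw [Set.image_add_right]
  simp [lastSection, ← sub_eq_add_neg, joinLast_sub_joinLast]

theorem exists_ae_eq_image_steinerSymm {s : ℝ} (hs : 0 < s) (hK : IsConvexBody K)
    (hKo : IsOriginSymmetric K) (hKl : IsSymmetricLast K) (hKs : StrictConvex ℝ K)
    (hE : MeasurableSet E) (hEf : volume E < ∞) (hP : fracPerimeter s E K < ∞)
    (heq : fracPerimeter s E K = fracPerimeter s (steinerSymm E) K) :
    ∃ v, E =ᵐ[volume] (fun x => x + v) '' steinerSymm E := by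
  have hpair := Measure.ae_ae_of_ae_prod
    (ae_lastSection_ae_eq_closedBall hs hK hKo hKl hKs hE hEf hP heq)
  obtain ⟨c, hc⟩ : ∃ c : ℝ, ∀ᵐ x, volume (lastSection E x) ≠ 0 →
      lastSection E x =ᵐ[volume] Metric.closedBall c ((volume (lastSection E x)).toReal / 2) := by
    by_cases h0 : ∀ᵐ x, volume (lastSection E x) = 0
    · exact ⟨0, h0.mono fun x hx hx' => absurd hx hx'⟩
    -- One non-null section that pairs well with almost every other is frozen; its centre serves for
    -- all.
    · obtain ⟨x, hx0, hx⟩ := ((Filter.not_eventually.1 h0).and_eventually hpair).exists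
      exact ⟨essCenter (lastSection E x), hx.mono fun y hy => hy hx0⟩
  refine ⟨joinLast 0 c, ae_eq_of_ae_lastSection_ae_eq hE
    ((measurableEmbedding_addRight _).measurableSet_image.2 (measurableSet_steinerSymm hE)) ?_⟩
  filter_upwards [hc, ae_volume_lastSection_ne_top hE hEf] with x hx hxf
  rw [lastSection_image_add_joinLast_zero, lastSection_steinerSymm]
  by_cases h0 : volume (lastSection E x) = 0
  · refine (ae_eq_empty.2 h0).trans (ae_eq_empty.2 ?_).symm
    rw [Set.image_add_right, measure_preimage_add_right, volume_schwarzSymm, h0]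
  · refine (hx h0).trans (Filter.EventuallyEq.of_eq ?_)
    rw [schwarzSymm, if_neg hxf]
    ext t
    simp [sub_eq_add_neg]

end Steiner

theorem mainTheorem4 (d : ℕ) (s : ℝ) (hs0 : 0 < s) (hs1 : s < 1)
    (K : Set (EuclideanSpace ℝ (Fin (d + 1))))
    (hK : IsConvexBody K) (hKo : IsOriginSymmetric K) (hKl : IsSymmetricLast K)
    (E : Set (EuclideanSpace ℝ (Fin (d + 1))))
    (hE : MeasurableSet E) (hEfin : volume E < ∞) :
    fracPerimeter s (steinerSymm E) K ≤ fracPerimeter s E K ∧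
    (StrictConvex ℝ K →
      ((∃ v : EuclideanSpace ℝ (Fin (d + 1)),
          E =ᵐ[volume] (fun x => x + v) '' steinerSymm E) →
        fracPerimeter s E K = fracPerimeter s (steinerSymm E) K) ∧
      (fracPerimeter s E K < ∞ →
        fracPerimeter s E K = fracPerimeter s (steinerSymm E) K →
        ∃ v : EuclideanSpace ℝ (Fin (d + 1)),
          E =ᵐ[volume] (fun x => x + v) '' steinerSymm E)) := by
  refine ⟨fracPerimeter_steinerSymm_le hs0 hK hKo hKl hE hEfin, fun hKs => ⟨?_, fun hP heq =>
    exists_ae_eq_image_steinerSymm hs0 hK hKo hKl hKs hE hEfin hP heq⟩⟩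
  rintro ⟨v, hv⟩
  rw [fracPerimeter_congr_ae s hv, fracPerimeter_image_add_right]
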